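/- **Model.** $k$ machines with distinct IDs, joined by a complete network, work in synchronous rounds. A cloud stores $x\in\{0,1\}^n$, $n>k\ge 1$. In each round every machine generates local random bits, sends a batch of queries $i$ to the cloud and receives the bits $x_i$, then sends at most one message of $O(\log n)$ bits to each machine, and receives the messages sent to it. Let $0\le\beta<1$ with $\beta k$ an integer, and $\gamma=1-\beta$; the algorithm knows $n,k,\beta$. In the model $\mathbf{Harsh}(\beta)$ an adversary that knows $x$ may, at the start of each round, corrupt further machines, depending on all local random bits and all communication of the earlier rounds; in total it corrupts at most $\beta k$ machines. From then on corrupted machines send arbitrary messages of the adversary's choice (which may even depend on the random bits of the current round). A machine that is never corrupted is honest. Let $\mathcal Q$ be the maximum number of queries made by an honest machine, $\mathcal T$ the number of rounds until all honest machines have terminated, and $\mathcal M$ the total number of messages sent by honest machines. Download is solved if every honest machine outputs $x$. **Algorithm $\texttt{Blacklist\_Download}$.** Let $\rho=\max\{1,\,k\sqrt{\gamma\beta/(8n)}\}$ and $p=\min\{1,(9\ln n+4\rho)/(\gamma k)\}$. Each machine keeps a set $B$, initially empty, and for $i=1,\dots,n$ does the following, in two rounds. (First round) With probability $p$, independently of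 everything else, it joins the committee of $i$; if it joined, it queries $x_i$ and sends the answer to all machines (including itself). Let $S_j$ be the set of machines not in $B$ from which it received $j$, for $j\in\{0,1\}$. (Second round) If $\min(|S_0|,|S_1|)\ge\rho$, it queries $x_i$, sets $res[i]=x_i$ and adds $S_{1-x_i}$ to $B$; otherwise it sets $res[i]$ to a $j$ with the larger $|S_j|$ (to $0$ in case of a tie). After the last iteration it outputs $res$. **Theorem.** (1) For every fixed $\beta\in[0,1)$ there is a constant $C=C(\beta)$ such that for all $n>k\ge1$ with $\beta k$ integral, all inputs $x\in\{0,1\}^n$ and all adversaries in $\mathbf{Harsh}(\beta)$, with probability at least $1-C/n$ Algorithm $\texttt{Blacklist\_Download}$ solves Download with $$\mathcal Q\le C\Big(\frac{n\log n}{\gamma k}+\sqrt n\Big),\qquad \mathcal T\le C n,\qquad \mathcal M\le C\big(kn\log n+k^2\sqrt{\gamma n}\big).$$ (2) There is an absolute constant $C$ such that, for all $\beta\in[0,1)$ and all $n,k,x$ and adversaries as in (1), with probability at least $1-C/n$ the algorithm solves Download with $$\mathcal Q\le C\Big(\frac{n\log n}{\gamma k}+\sqrt{\tfrac{\beta}{\gamma}\,n}\Big),\qquad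 \mathcal T\le C n,\qquad \mathcal M\le C\,\frac{h}{\gamma k}\big(kn\log n+k^2\sqrt{\gamma n}\big),$$ where $h\ge\gamma k$ is the number of honest machines. In both parts messages have at most $C\log n$ bits. -/

import Mathlib

open MeasureTheory

noncomputable section

namespace CCA

/-- A randomized synchronous protocol for `k` machines (with IDs in `Fin k`) connected by a
complete network, with read-only access to an `n`-bit array stored in a cloud. In every round a
machine tosses its local coin, then sends a batch of queries to the cloud and gets the answers
(query sub-round), then sends at most one message to every machine, and finally updates its state
from the messages it received (message-passing sub-round). All machines run the same code, which
may use the machine's ID. -/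
structure Protocol (n k : ℕ) where
  State : Type
  Msg : Type
  finiteMsg : Finite Msg
  Coin : Type
  coinSpace : MeasurableSpace Coin
  /-- The law of the local randomness that one machine generates in one round. -/
  coinLaw : Measure Coin
  coinProb : IsProbabilityMeasure coinLaw
  init : Fin k → State
  /-- The set of indices that the machine queries in this round. -/
  query : Fin k → State → Coin → Finset (Fin n)
  /-- The message for each receiver; the third explicit argument holds the cloud's answers. -/
  send : Fin k → State → Coin → (Fin n → Option Bool) → Fin k → Option Msg
  /-- The new state, from the cloud's answers and the message received from each sender. -/
  update : Fin k → State → Coin → (Fin n → Option Bool) → (Fin k → Option Msg) → State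
  /-- `some y` once the machine has terminated with output `y`. -/
  output : State → Option (Fin n → Bool)

attribute [instance] Protocol.finiteMsg Protocol.coinSpace Protocol.coinProb

/-- An adaptive adversary. `corrupt t` is the set of machines that it corrupts at the start of
round `t`; it may depend on all local coins of all machines in the rounds before `t`. (The
adversary is chosen after the protocol and the input, and the whole communication of the rounds
before `t` is a function of the input, these coins and the adversary's own moves, so it may depend
on the input and on that communication too.) `speak t _ m m'` is what the machine `m`, if
corrupted, sends to `m'` in round `t`; here even the coins of round `t` itself are known. -/
structure Adversary (k : ℕ) (Coin Msg : Type) where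
  corrupt : (t : ℕ) → (Fin t → Fin k → Coin) → Finset (Fin k)
  speak : (t : ℕ) → (Fin (t + 1) → Fin k → Coin) → Fin k → Fin k → Option Msg

namespace Adversary

variable {k : ℕ} {Coin Msg : Type}

/-- The machines corrupted at the start of round `t` or earlier, when `ω s m` is the coin of
machine `m` in round `s`. -/
def corrupted (A : Adversary k Coin Msg) (ω : ℕ → Fin k → Coin) (t : ℕ) : Finset (Fin k) :=
  (Finset.range (t + 1)).biUnion fun s => A.corrupt s fun i : Fin s => ω i

/-- The adversary never corrupts more than `b` machines in total. -/
def HasBudget (A : Adversary k Coin Msg) (b : ℕ) : Prop :=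
  ∀ ω t, (A.corrupted ω t).card ≤ b

open Classical in
/-- The honest machines: those that are never corrupted during the execution. -/
def honest (A : Adversary k Coin Msg) (ω : ℕ → Fin k → Coin) : Finset (Fin k) :=
  Finset.univ.filter fun m => ∀ t, m ∉ A.corrupted ω t

end Adversary

/-- The cloud's answers to a batch `q` of queries. -/
def cloudAnswers {n : ℕ} (x : Fin n → Bool) (q : Finset (Fin n)) : Fin n → Option Bool :=
  fun i => if i ∈ q then some (x i) else none

namespace Protocol

variable {n k : ℕ}

/-- The queries of a machine in one round; a terminated machine makes none. -/
def queries (P : Protocol n k) (m : Fin k) (s : P.State) (c : P.Coin) : Finset (Fin n) :=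
  if (P.output s).isSome then ∅ else P.query m s c

/-- The messages that the protocol prescribes; a terminated machine sends none. -/
def messages (P : Protocol n k) (x : Fin n → Bool) (m : Fin k) (s : P.State) (c : P.Coin) :
    Fin k → Option P.Msg :=
  if (P.output s).isSome then fun _ => none
  else P.send m s c (cloudAnswers x (P.queries m s c))

/-- The states of all machines at the start of round `t` in the execution on input `x` against the
adversary `A`, with coins `ω`. The messages of the corrupted machines are those of the adversary;
the state recorded for a corrupted machine has no influence on the other machines. -/
def state (P : Protocol n k) (x : Fin n → Bool) (A : Adversary k P.Coin P.Msg)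
    (ω : ℕ → Fin k → P.Coin) : ℕ → Fin k → P.State
  | 0 => P.init
  | t + 1 => fun m =>
      let s := P.state x A ω t m
      if (P.output s).isSome then s
      else P.update m s (ω t m) (cloudAnswers x (P.queries m s (ω t m))) fun m' =>
        if m' ∈ A.corrupted ω t then A.speak t (fun i => ω i) m' m
        else P.messages x m' (P.state x A ω t m') (ω t m') m

/-- The number of queries that machine `m` makes in the rounds before round `T`. -/
def queryCount (P : Protocol n k) (x : Fin n → Bool) (A : Adversary k P.Coin P.Msg)
    (ω : ℕ → Fin k → P.Coin) (T : ℕ) (m : Fin k) : ℕ :=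
  ∑ t ∈ Finset.range T, (P.queries m (P.state x A ω t m) (ω t m)).card

/-- The number of messages that machine `m` sends, as an honest machine, in the rounds before
round `T`. -/
def messageCount (P : Protocol n k) (x : Fin n → Bool) (A : Adversary k P.Coin P.Msg)
    (ω : ℕ → Fin k → P.Coin) (T : ℕ) (m : Fin k) : ℕ :=
  ∑ t ∈ Finset.range T,
    (Finset.univ.filter fun m' =>
      (P.messages x m (P.state x A ω t m) (ω t m) m').isSome).card

/-- In the execution, all honest machines terminate within `Tb` rounds with output `x`, each of
them makes at most `Qb` queries, and together they send at most `Mb h` messages, where `h` is the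
number of honest machines. (Terminated machines neither query nor send, so the counts up to the
common termination time `T` are those of the whole execution.) -/
def DownloadsWithin (P : Protocol n k) (x : Fin n → Bool) (A : Adversary k P.Coin P.Msg)
    (ω : ℕ → Fin k → P.Coin) (Qb Tb : ℝ) (Mb : ℕ → ℝ) : Prop :=
  ∃ T : ℕ, (T : ℝ) ≤ Tb ∧
    (∀ m ∈ A.honest ω, P.output (P.state x A ω T m) = some x) ∧
    (∀ m ∈ A.honest ω, (P.queryCount x A ω T m : ℝ) ≤ Qb) ∧
    ((∑ m ∈ A.honest ω, P.messageCount x A ω T m : ℕ) : ℝ) ≤ Mb (A.honest ω).card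

/-- The law of all coins: independent, over all rounds and machines, each with law `coinLaw`. -/
def coinMeasure (P : Protocol n k) : Measure (ℕ → Fin k → P.Coin) :=
  Measure.infinitePi fun _ : ℕ => Measure.pi fun _ : Fin k => P.coinLaw

/-- The number of bits needed to encode a message. -/
def messageBits (P : Protocol n k) : ℕ := Nat.clog 2 (Nat.card P.Msg)

/-- `P` uses messages of at most `bits` bits and, for every input and every adaptive adversary that
corrupts at most `b` machines, it solves Download within the complexity bounds `Qb` (queries per
honest machine), `Tb` (rounds) and `Mb` (messages of all honest machines), except with probability
at most `fail`. -/
def SolvesDownload (P : Protocol n k) (b : ℕ) (fail bits Qb Tb : ℝ) (Mb : ℕ → ℝ) : Prop :=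
  (P.messageBits : ℝ) ≤ bits ∧
  ∀ (x : Fin n → Bool) (A : Adversary k P.Coin P.Msg), A.HasBudget b →
    P.coinMeasure {ω | ¬ P.DownloadsWithin x A ω Qb Tb Mb} ≤ ENNReal.ofReal fail

end Protocol

/-! ### The algorithm `Blacklist_Download` -/

/-- The representation parameter `ρ = max (1, k √(γβ / (8n)))`, where `γ = 1 - β`. -/
def rho (n k : ℕ) (β : ℝ) : ℝ := max 1 (k * √((1 - β) * β / (8 * n)))

/-- The probability `min (1, (9 ln n + 4ρ) / (γk))` with which a machine elects itself into the
private committee of a given bit. (`Set.projIcc` truncates to the interval `[0, 1]`.) -/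
def electProb (n k : ℕ) (β : ℝ) : unitInterval :=
  Set.projIcc (0 : ℝ) 1 zero_le_one ((9 * Real.log n + 4 * rho n k β) / ((1 - β) * k))

/-- The local variables of a machine. -/
structure BlacklistState (n k : ℕ) where
  /-- The (0-based) index of the bit that is currently treated. -/
  iter : ℕ
  /-- `none` in the voting round of the iteration; in its second round `some S`, where `S j` is the
  set of machines, not blacklisted, that sent `j`. -/
  votes : Option (Bool → Finset (Fin k))
  /-- The machines known to be faulty. -/
  blacklist : Finset (Fin k)
  res : Fin n → Bool

/-- The cloud's answer on the index `i`, if there is one. -/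
def answerAt {n : ℕ} (ans : Fin n → Option Bool) (i : ℕ) : Option Bool :=
  if h : i < n then ans ⟨i, h⟩ else none

/-- The assignment `res[i] ← v`. -/
def assign {n : ℕ} (res : Fin n → Bool) (i : ℕ) (v : Bool) : Fin n → Bool :=
  fun j => if (j : ℕ) = i then v else res j

/-- Queries: in the voting round, a member of the committee queries the current bit; in the second
round, a machine queries it if both values have at least `ρ` votes. -/
def blacklistQuery (n k : ℕ) (β : ℝ) (s : BlacklistState n k) (c : Bool) : Finset (Fin n) :=
  open Classical in
  match s.votes with
  | none => Finset.univ.filter fun i => (i : ℕ) = s.iter ∧ c = true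
  | some S => Finset.univ.filter fun i => (i : ℕ) = s.iter ∧
      rho n k β ≤ min ((S false).card : ℝ) ((S true).card : ℝ)

/-- The message to every machine: in the voting round, a member of the committee sends the value of
the current bit (the others made no query and hence send nothing). -/
def blacklistSend {n k : ℕ} (s : BlacklistState n k) (ans : Fin n → Option Bool) : Option Bool :=
  match s.votes with
  | none => answerAt ans s.iter
  | some _ => none

/-- State change: the votes are recorded in the voting round; in the second round `res` and the
blacklist are updated. -/
def blacklistUpdate {n k : ℕ} (s : BlacklistState n k) (ans : Fin n → Option Bool)
    (inbox : Fin k → Option Bool) : BlacklistState n k :=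
  match s.votes with
  | none =>
      { s with
        votes := some fun j =>
          Finset.univ.filter fun m' => m' ∉ s.blacklist ∧ inbox m' = some j }
  | some S =>
      match answerAt ans s.iter with
      | some v => ⟨s.iter + 1, none, s.blacklist ∪ S (!v), assign s.res s.iter v⟩
      | none => ⟨s.iter + 1, none, s.blacklist,
          assign s.res s.iter (decide ((S false).card < (S true).card))⟩

/-- Algorithm `Blacklist_Download`. The iteration for the bit `i` takes two rounds.

Voting round: the machine elects itself into the private committee of `i` if its coin, of bias
`electProb n k β`, shows `true`. A member of the committee queries bit `i` and sends its value to
all machines (including itself, i.e. it counts its own vote). Then every machine records the sets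
`S j` of the machines outside its blacklist that sent `j`.

Resolution round: if both `S false` and `S true` have at least `ρ` elements, the machine queries
bit `i`, and blacklists all the machines that sent the wrong value. Otherwise it sets `res[i]` to
the value with more votes. No messages are sent in this round. -/
abbrev blacklistDownload (n k : ℕ) (β : ℝ) : Protocol n k where
  State := BlacklistState n k
  Msg := Bool
  finiteMsg := inferInstance
  Coin := Bool
  coinSpace := inferInstance
  coinLaw := ProbabilityTheory.bernoulliMeasure true false (electProb n k β)
  coinProb := inferInstance
  init := fun _ => ⟨0, none, ∅, fun _ => false⟩
  query := fun _ s c => blacklistQuery n k β s c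
  send := fun _ s _ ans _ => blacklistSend s ans
  update := fun _ s _ ans inbox => blacklistUpdate s ans inbox
  output := fun s => if s.iter = n then some s.res else none

end CCA

end

/-! Write γ = 1 - β. Randomness enters through two kinds of event: every committee has at least ρ
uncorrupted members, and no machine joins far more committees than expected. Given both, the rest is
deterministic (`invariant`, `downloadsWithin`). Wrong votes come only from corrupted machines, so
blacklists contain only corrupted machines and the true value always gets ρ votes; a wrong value
that is not outvoted then causes a dispute, which a query settles. Each dispute blacklists at least
ρ new corrupted machines, so a machine settles at most βk/ρ of them. Committee work costs about np ≤
n(9 ln n + 4ρ)/(γk) queries. The choice of ρ makes βk/ρ, and nρ/(γk) up to a logarithmic term, of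
order √(βn/γ) (`mul_le_sqrt_mul_rho`, `mul_rho_div_le`).

Adaptivity does no harm: the set corrupted by a voting round is a function of earlier coins, hence
independent of the coins of that round (`coins_real_adaptive_le`). At least γk machines are still
uncorrupted, so a Chernoff bound applies. Each bad event has probability at most 1/n², and there are
n + k < 2n of them. What corrupted machines send is arbitrary in the deterministic part, so it may
depend on current coins. -/

namespace CCA

open ProbabilityTheory

/-! ### Chernoff bounds for Bernoulli trials -/

section Chernoff

variable {Ω ι : Type*} {mΩ : MeasurableSpace Ω} {μ : Measure Ω} {Y : ι → Ω → Bool}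
  {p : unitInterval}

lemma card_filter_eq_sum_toNat (s : Finset ι) (c : ι → Bool) :
    ((s.filter fun i => c i = true).card : ℝ) = ∑ i ∈ s, ((c i).toNat : ℝ) := by
  rw [Finset.card_filter]
  push_cast
  refine Finset.sum_congr rfl fun i _ => ?_
  cases c i <;> simp

/-- The moment generating function of the number of successes among independent Bernoulli
trials. -/
lemma mgf_card_filter (hind : iIndepFun Y μ) (hY : ∀ i, Measurable (Y i))
    (hlaw : ∀ i, μ.map (Y i) = bernoulliMeasure true false p) (s : Finset ι) (t : ℝ) :
    mgf (fun ω => ((s.filter fun i => Y i ω = true).card : ℝ)) μ t =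
      (p * Real.exp t + (1 - p)) ^ s.card := by
  have hm : Measurable fun c : Bool => (c.toNat : ℝ) := .of_discrete
  have h := (hind.comp (fun _ c => (c.toNat : ℝ)) fun _ => hm).mgf_sum (t := t)
    (fun i => hm.comp (hY i)) s
  have hcard : (fun ω => ((s.filter fun i => Y i ω = true).card : ℝ)) =
      ∑ i ∈ s, (fun c : Bool => (c.toNat : ℝ)) ∘ Y i := by
    ext ω
    simp [card_filter_eq_sum_toNat]
  rw [hcard, h]
  refine Finset.prod_eq_pow_card fun i _ => ?_
  rw [← mgf_map (X := fun c : Bool => (c.toNat : ℝ)) (hY i).aemeasurable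
    (by exact (Measurable.of_discrete).aestronglyMeasurable), hlaw, mgf, bernoulliMeasure_def,
    integral_add_measure (by simp) (by simp)]
  simp [NNReal.smul_def]

lemma mgf_card_filter_le (hind : iIndepFun Y μ) (hY : ∀ i, Measurable (Y i))
    (hlaw : ∀ i, μ.map (Y i) = bernoulliMeasure true false p) (s : Finset ι) (t : ℝ) :
    mgf (fun ω => ((s.filter fun i => Y i ω = true).card : ℝ)) μ t ≤
      Real.exp (s.card * (p * (Real.exp t - 1))) := by
  rw [mgf_card_filter hind hY hlaw, Real.exp_nat_mul]
  have h0 := p.2.1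
  have h1 := p.2.2
  have := Real.exp_pos t
  refine pow_le_pow_left₀ (by nlinarith) ?_ _
  linarith [Real.add_one_le_exp (p * (Real.exp t - 1) : ℝ)]

lemma integrable_exp_card_filter [IsProbabilityMeasure μ] (hY : ∀ i, Measurable (Y i))
    (s : Finset ι) (t : ℝ) :
    Integrable (fun ω => Real.exp (t * ((s.filter fun i => Y i ω = true).card : ℝ))) μ := by
  have hmeas : Measurable fun ω => ((s.filter fun i => Y i ω = true).card : ℝ) := by
    simp_rw [card_filter_eq_sum_toNat]
    exact Finset.measurable_sum _ fun i _ =>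
      (Measurable.of_discrete (f := fun c : Bool => (c.toNat : ℝ))).comp (hY i)
  refine Integrable.of_bound (C := Real.exp (|t| * s.card))
    (hmeas.const_mul t).exp.aestronglyMeasurable (.of_forall fun ω => ?_)
  rw [Real.norm_of_nonneg (Real.exp_pos _).le, Real.exp_le_exp]
  have : ((s.filter fun i => Y i ω = true).card : ℝ) ≤ s.card := by
    exact_mod_cast Finset.card_filter_le _ _
  exact mul_le_mul (le_abs_self t) this (by positivity) (abs_nonneg t)

/-- Upper tail of the number of successes. -/
lemma measureReal_le_card_filter [IsProbabilityMeasure μ] (hind : iIndepFun Y μ)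
    (hY : ∀ i, Measurable (Y i)) (hlaw : ∀ i, μ.map (Y i) = bernoulliMeasure true false p)
    (s : Finset ι) (a : ℝ) :
    μ.real {ω | 2 * (s.card * (p : ℝ)) + a ≤ ((s.filter fun i => Y i ω = true).card : ℝ)} ≤
      Real.exp (-a) := by
  refine (measure_ge_le_exp_mul_mgf _ zero_le_one (integrable_exp_card_filter hY s 1)).trans ?_
  refine (mul_le_mul_of_nonneg_left (mgf_card_filter_le hind hY hlaw s 1)
    (Real.exp_pos _).le).trans ?_
  rw [← Real.exp_add, Real.exp_le_exp]
  have h0 : 0 ≤ (s.card : ℝ) * p := mul_nonneg (by positivity) p.2.1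
  -- The exponent is at most -a because e - 1 ≤ 2.
  nlinarith [Real.exp_one_lt_d9]

/-- Lower tail of the number of successes. -/
lemma measureReal_card_filter_le [IsProbabilityMeasure μ] (hind : iIndepFun Y μ)
    (hY : ∀ i, Measurable (Y i)) (hlaw : ∀ i, μ.map (Y i) = bernoulliMeasure true false p)
    (s : Finset ι) (a : ℝ) :
    μ.real {ω | ((s.filter fun i => Y i ω = true).card : ℝ) ≤ a} ≤
      Real.exp (a - s.card * p / 2) := by
  refine (measure_le_le_exp_mul_mgf (t := -1) _ (by norm_num)
    (integrable_exp_card_filter hY s (-1))).trans ?_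
  refine (mul_le_mul_of_nonneg_left (mgf_card_filter_le hind hY hlaw s (-1))
    (Real.exp_pos _).le).trans ?_
  rw [← Real.exp_add, Real.exp_le_exp]
  have h0 : 0 ≤ (s.card : ℝ) * p := mul_nonneg (by positivity) p.2.1
  -- Here 1 - 1/e ≥ 1/2.
  nlinarith [Real.exp_neg_one_lt_d9]

end Chernoff

/-! ### Independence of the coins, also against an adaptive choice -/

section Coins

variable {k : ℕ}

lemma iIndepFun_coins_round (p : unitInterval) :
    iIndepFun (fun (m : Fin k) (c : Fin k → Bool) => c m)
      (Measure.pi fun _ : Fin k => bernoulliMeasure true false p) :=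
  iIndepFun_pi (X := fun _ => id) fun _ => aemeasurable_id

/-- The coins of all rounds and machines, each of which shows `true` with probability `p`. -/
noncomputable abbrev coins (k : ℕ) (p : unitInterval) : Measure (ℕ → Fin k → Bool) :=
  Measure.infinitePi fun _ : ℕ => Measure.pi fun _ : Fin k => bernoulliMeasure true false p

lemma coins_map_eval (p : unitInterval) (t : ℕ) (m : Fin k) :
    (coins k p).map (fun ω => ω t m) = bernoulliMeasure true false p := by
  have h := ((measurePreserving_eval (fun _ : Fin k => bernoulliMeasure true false p) m).comp
    (measurePreserving_eval_infinitePi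
      (fun _ : ℕ => Measure.pi fun _ : Fin k => bernoulliMeasure true false p) t)).map_eq
  exact h

/-- Coins are tossed in every round but matter only in voting rounds; `r` will be doubling. -/
lemma iIndepFun_coins_machine (p : unitInterval) (m : Fin k) {r : ℕ → ℕ}
    (hr : Function.Injective r) :
    iIndepFun (fun (i : ℕ) (ω : ℕ → Fin k → Bool) => ω (r i) m) (coins k p) :=
  (iIndepFun_infinitePi (X := fun _ (c : Fin k → Bool) => c m) (by fun_prop)).precomp hr

/-- The number of successes of one machine in `n` distinct rounds, upper tail. -/
lemma coins_le_card_filter (p : unitInterval) (m : Fin k) {r : ℕ → ℕ}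
    (hr : Function.Injective r) (n : ℕ) (a : ℝ) :
    (coins k p).real {ω | 2 * (n * (p : ℝ)) + a ≤
      (((Finset.range n).filter fun i => ω (r i) m = true).card : ℝ)} ≤ Real.exp (-a) := by
  have := measureReal_le_card_filter (iIndepFun_coins_machine p m hr)
    (fun i => by fun_prop) (fun i => coins_map_eval p (r i) m) (Finset.range n) a
  simpa using this

/-- A bound for an event about the coins of round `t` and a fixed set `G` of machines, uniform in
`G`, remains valid when `G` is a function of the coins of the earlier rounds. -/
lemma coins_real_adaptive_le (p : unitInterval) (t : ℕ)
    (G : (Fin t → Fin k → Bool) → Finset (Fin k)) (E : Finset (Fin k) → Set (Fin k → Bool))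
    {δ : ℝ}
    (hE : ∀ g, (Measure.pi fun _ : Fin k => bernoulliMeasure true false p).real (E (G g)) ≤ δ) :
    (coins k p).real {ω | ω t ∈ E (G fun i => ω i)} ≤ δ := by
  classical
  set ν := Measure.pi fun _ : Fin k => bernoulliMeasure true false p with hν
  have hind : IndepFun (fun (ω : ℕ → Fin k → Bool) (i : Fin t) => ω i) (fun ω => ω t)
      (coins k p) := by
    have h := (iIndepFun_infinitePi (P := fun _ : ℕ => ν) (X := fun _ c => c)
      (fun _ => measurable_id)).indepFun_finset (Finset.range t) {t} (by simp) (by fun_prop)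
    exact h.comp
      (φ := fun (f : Finset.range t → Fin k → Bool) (i : Fin t) => f ⟨i, by simp⟩)
      (ψ := fun (f : ({t} : Finset ℕ) → Fin k → Bool) => f ⟨t, by simp⟩)
      (by fun_prop) (by fun_prop)
  -- These spaces are finite, so neither `E` nor `G` needs a measurability hypothesis.
  have hmeas : ∀ A : Set (Fin k → Bool), MeasurableSet A := fun A => .of_discrete
  have hmeas' : ∀ A : Set (Fin t → Fin k → Bool), MeasurableSet A := fun A => .of_discrete
  have hmp := measurePreserving_eval_infinitePi (fun _ : ℕ => ν) t
  have hpast : Measurable fun (ω : ℕ → Fin k → Bool) (i : Fin t) => ω i := by fun_prop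
  -- Condition on the finitely many pasts `g`; on each of them the chosen set is the constant `G g`.
  have hsplit : {ω : ℕ → Fin k → Bool | ω t ∈ E (G fun i => ω i)} =
      ⋃ g ∈ (Finset.univ : Finset (Fin t → Fin k → Bool)),
        ((fun ω (i : Fin t) => ω i) ⁻¹' {g}) ∩ ((fun ω => ω t) ⁻¹' E (G g)) := by
    ext ω
    simp
  have hprob : ∑ g : Fin t → Fin k → Bool,
      (coins k p).real ((fun ω (i : Fin t) => ω i) ⁻¹' {g}) = 1 := by
    rw [← measureReal_biUnion_finset (fun g _ g' _ hgg' => Disjoint.preimage _ (by simpa using hgg'))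
      fun g _ => hpast (hmeas' _)]
    rw [show (⋃ g ∈ (Finset.univ : Finset (Fin t → Fin k → Bool)),
      (fun (ω : ℕ → Fin k → Bool) (i : Fin t) => ω i) ⁻¹' {g}) = Set.univ by ext; simp]
    simp
  calc (coins k p).real {ω | ω t ∈ E (G fun i => ω i)}
      ≤ ∑ g, (coins k p).real
          (((fun ω (i : Fin t) => ω i) ⁻¹' {g}) ∩ ((fun ω => ω t) ⁻¹' E (G g))) := by
        rw [hsplit]
        exact measureReal_biUnion_finset_le _ _
    _ ≤ ∑ g, (coins k p).real ((fun ω (i : Fin t) => ω i) ⁻¹' {g}) * δ := by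
        refine Finset.sum_le_sum fun g _ => ?_
        rw [measureReal_def, hind.measure_inter_preimage_eq_mul _ _ (hmeas' _) (hmeas _),
          ENNReal.toReal_mul]
        refine mul_le_mul_of_nonneg_left ?_ ENNReal.toReal_nonneg
        have h := hmp.measure_preimage (hmeas (E (G g))).nullMeasurableSet
        exact (congrArg ENNReal.toReal h).trans_le (hE g)
    _ = δ := by rw [← Finset.sum_mul, hprob, one_mul]

end Coins

/-! ### Deterministic analysis of an execution -/

section Execution

variable {n k : ℕ} {β : ℝ}

lemma answerAt_cloudAnswers (x : Fin n → Bool) (q : Finset (Fin n)) (i : Fin n) :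
    answerAt (cloudAnswers x q) i = if i ∈ q then some (x i) else none := by
  simp [answerAt, cloudAnswers]

lemma output_isSome_eq_false (s : BlacklistState n k) {i : Fin n} (hs : s.iter = i) :
    ((blacklistDownload n k β).output s).isSome = false := by
  simp [hs, i.2.ne]

lemma queries_voting (m : Fin k) {s : BlacklistState n k} {i : Fin n} (hs : s.iter = i)
    (hv : s.votes = none) (c : Bool) :
    (blacklistDownload n k β).queries m s c = if c then {i} else ∅ := by
  rw [Protocol.queries, output_isSome_eq_false s hs]
  ext j
  cases c <;> simp [blacklistQuery, hs, hv, Fin.ext_iff]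

open Classical in
lemma queries_resolution (m : Fin k) {s : BlacklistState n k} {i : Fin n} (hs : s.iter = i)
    {S : Bool → Finset (Fin k)} (hv : s.votes = some S) (c : Bool) :
    (blacklistDownload n k β).queries m s c =
      if rho n k β ≤ min ((S false).card : ℝ) ((S true).card : ℝ) then {i} else ∅ := by
  rw [Protocol.queries, output_isSome_eq_false s hs]
  ext j
  simp only [blacklistQuery, hs, hv]
  split_ifs with h <;> simp_all [Fin.ext_iff]

lemma messages_voting (x : Fin n → Bool) (m : Fin k) {s : BlacklistState n k} {i : Fin n}
    (hs : s.iter = i) (hv : s.votes = none) (c : Bool) (m' : Fin k) :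
    (blacklistDownload n k β).messages x m s c m' = if c then some (x i) else none := by
  rw [Protocol.messages, output_isSome_eq_false s hs, queries_voting m hs hv]
  simp only [blacklistSend, hv, hs, answerAt_cloudAnswers]
  cases c <;> simp

lemma messages_resolution (x : Fin n → Bool) (m : Fin k) {s : BlacklistState n k} {i : Fin n}
    (hs : s.iter = i) {S : Bool → Finset (Fin k)} (hv : s.votes = some S) (c : Bool)
    (m' : Fin k) :
    (blacklistDownload n k β).messages x m s c m' = none := by
  rw [Protocol.messages, output_isSome_eq_false s hs]
  simp [blacklistSend, hv]

variable (x : Fin n → Bool) (A : Adversary k Bool Bool) (ω : ℕ → Fin k → Bool)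

/-- What `m'` sends to `m` in the voting round of the bit `i`. -/
def vote (i : Fin n) (m m' : Fin k) : Option Bool :=
  if m' ∈ A.corrupted ω (2 * i) then A.speak (2 * i) (fun j => ω j) m' m
  else if ω (2 * i) m' then some (x i) else none

/-- The machines outside `B` that send the value `j` to `m` in the voting round of the bit `i`. -/
def tally (i : Fin n) (m : Fin k) (B : Finset (Fin k)) (j : Bool) : Finset (Fin k) :=
  Finset.univ.filter fun m' => m' ∉ B ∧ vote x A ω i m m' = some j

/-- Both values have at least `ρ` votes for the bit `i`. -/
def Disputed (β : ℝ) (i : Fin n) (m : Fin k) (B : Finset (Fin k)) : Prop :=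
  rho n k β ≤ min ((tally x A ω i m B false).card : ℝ) ((tally x A ω i m B true).card : ℝ)

/-- The members of the committee of bit `i` that are not corrupted. -/
def loyalCommittee (i : ℕ) : Finset (Fin k) :=
  (A.corrupted ω (2 * i))ᶜ.filter fun m => ω (2 * i) m = true

variable {x A ω} in
lemma mem_tally {i : Fin n} {m m' : Fin k} {B : Finset (Fin k)} {j : Bool} :
    m' ∈ tally x A ω i m B j ↔ m' ∉ B ∧ vote x A ω i m m' = some j := by
  simp [tally]

/-- An uncorrupted machine either votes for the true bit or stays silent. -/
lemma tally_not_subset_corrupted (i : Fin n) (m : Fin k) (B : Finset (Fin k)) :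
    tally x A ω i m B (!x i) ⊆ A.corrupted ω (2 * i) := by
  intro m' hm'
  by_contra h
  rw [mem_tally, vote, if_neg h] at hm'
  cases h' : ω (2 * i) m' <;> simp [h'] at hm'

/-- A blacklist of corrupted machines cannot discard the vote of an uncorrupted one. -/
lemma loyalCommittee_subset_tally (i : Fin n) (m : Fin k) {B : Finset (Fin k)}
    (hB : B ⊆ A.corrupted ω (2 * i)) :
    loyalCommittee A ω i ⊆ tally x A ω i m B (x i) := by
  intro m' hm'
  simp only [loyalCommittee, Finset.mem_filter, Finset.mem_compl] at hm'
  rw [mem_tally, vote, if_neg hm'.1, if_pos hm'.2]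
  exact ⟨fun h => hm'.1 (hB h), rfl⟩

lemma corrupted_mono {s t : ℕ} (hst : s ≤ t) : A.corrupted ω s ⊆ A.corrupted ω t :=
  Finset.biUnion_subset_biUnion_of_subset_left _ (Finset.range_mono (by lia))

local notation "st" => Protocol.state (blacklistDownload n k β) x A ω

lemma state_voting {i : Fin n} (h : ∀ m, (st (2 * i) m).iter = i ∧ (st (2 * i) m).votes = none)
    (m : Fin k) :
    st (2 * i + 1) m =
      { st (2 * i) m with votes := some (tally x A ω i m (st (2 * i) m).blacklist) } := by
  have hne : ¬ (st (2 * i) m).iter = n := by rw [(h m).1]; exact i.2.ne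
  rw [Protocol.state]
  simp only [messages_voting x _ (h _).1 (h _).2, hne, if_false, Option.isSome_none,
    Bool.false_eq_true]
  simp only [blacklistUpdate, (h m).2]
  rfl

open Classical in
-- The machine has the cloud's answer exactly when the bit is disputed, since only then does it
-- query.
lemma state_resolution {i : Fin n}
    (h : ∀ m, (st (2 * i) m).iter = i ∧ (st (2 * i) m).votes = none) (m : Fin k) :
    st (2 * i + 2) m =
      if Disputed x A ω β i m (st (2 * i) m).blacklist then
        ⟨i + 1, none, (st (2 * i) m).blacklist ∪ tally x A ω i m (st (2 * i) m).blacklist (!x i),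
          assign (st (2 * i) m).res i (x i)⟩
      else
        ⟨i + 1, none, (st (2 * i) m).blacklist, assign (st (2 * i) m).res i
          (decide ((tally x A ω i m (st (2 * i) m).blacklist false).card <
            (tally x A ω i m (st (2 * i) m).blacklist true).card))⟩ := by
  have hs : (st (2 * i + 1) m).iter = i := by rw [state_voting x A ω h]; exact (h m).1
  have hv : (st (2 * i + 1) m).votes = some (tally x A ω i m (st (2 * i) m).blacklist) := by
    rw [state_voting x A ω h]
  have hne : ¬ (st (2 * i + 1) m).iter = n := by rw [hs]; exact i.2.ne
  rw [Protocol.state]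
  simp only [queries_resolution m hs hv, hne, if_false, Option.isSome_none, Bool.false_eq_true]
  simp only [blacklistUpdate, hv, hs, answerAt_cloudAnswers]
  rw [state_voting x A ω h]
  unfold Disputed
  split_ifs <;> simp_all

/-- The number of voting rounds among the first `i` in which `m` joins the committee. -/
def joinCount (i : ℕ) (m : Fin k) : ℕ :=
  ((Finset.range i).filter fun j => ω (2 * j) m = true).card

lemma joinCount_succ (i : ℕ) (m : Fin k) :
    joinCount ω (i + 1) m = joinCount ω i m + if ω (2 * i) m then 1 else 0 := by
  simp only [joinCount, Finset.card_filter, Finset.sum_range_succ]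

open Classical in
lemma queryCount_succ {i : Fin n}
    (h : ∀ m, (st (2 * i) m).iter = i ∧ (st (2 * i) m).votes = none) (m : Fin k) :
    (blacklistDownload n k β).queryCount x A ω (2 * i + 2) m =
      (blacklistDownload n k β).queryCount x A ω (2 * i) m + (if ω (2 * i) m then 1 else 0) +
        if Disputed x A ω β i m (st (2 * i) m).blacklist then 1 else 0 := by
  have hs : (st (2 * i + 1) m).iter = i := by rw [state_voting x A ω h]; exact (h m).1
  have hv : (st (2 * i + 1) m).votes = some (tally x A ω i m (st (2 * i) m).blacklist) := by
    rw [state_voting x A ω h]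
  rw [Protocol.queryCount, Finset.sum_range_succ, Finset.sum_range_succ,
    queries_voting m (h m).1 (h m).2, queries_resolution m hs hv, apply_ite Finset.card,
    apply_ite Finset.card]
  rfl

lemma messageCount_succ {i : Fin n}
    (h : ∀ m, (st (2 * i) m).iter = i ∧ (st (2 * i) m).votes = none) (m : Fin k) :
    (blacklistDownload n k β).messageCount x A ω (2 * i + 2) m =
      (blacklistDownload n k β).messageCount x A ω (2 * i) m + if ω (2 * i) m then k else 0 := by
  have hs : (st (2 * i + 1) m).iter = i := by rw [state_voting x A ω h]; exact (h m).1
  have hv : (st (2 * i + 1) m).votes = some (tally x A ω i m (st (2 * i) m).blacklist) := by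
    rw [state_voting x A ω h]
  rw [Protocol.messageCount, Finset.sum_range_succ, Finset.sum_range_succ]
  simp only [messages_voting x m (h m).1 (h m).2, messages_resolution x m hs hv]
  cases ω (2 * i) m <;> simp [Protocol.messageCount]

variable (β) in
/-- What holds for machine `m` after `i` iterations. The `r` iterations in which `m` verified a
disputed bit put at least `ρ` corrupted machines each on its blacklist. -/
structure Invariant (i : ℕ) (m : Fin k) : Prop where
  iter_eq : (st (2 * i) m).iter = i
  votes_eq : (st (2 * i) m).votes = none
  blacklist_subset : (st (2 * i) m).blacklist ⊆ A.corrupted ω (2 * i)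
  queryCount_eq : ∃ r : ℕ,
    (blacklistDownload n k β).queryCount x A ω (2 * i) m = joinCount ω i m + r ∧
      r * rho n k β ≤ (st (2 * i) m).blacklist.card
  messageCount_eq :
    (blacklistDownload n k β).messageCount x A ω (2 * i) m = k * joinCount ω i m
  res_eq : (∀ j < i, rho n k β ≤ (loyalCommittee A ω j).card) →
    ∀ j : Fin n, (j : ℕ) < i → (st (2 * i) m).res j = x j

/-- If the wrong value had at least as many votes as the true one, both would reach ρ and the bit
would be disputed. So the majority is strict and the tie rule never matters. -/
lemma res_step {i : Fin n} {m : Fin k} {B : Finset (Fin k)} (hB : B ⊆ A.corrupted ω (2 * i))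
    (hc : rho n k β ≤ (loyalCommittee A ω i).card) (hd : ¬ Disputed x A ω β i m B) :
    decide ((tally x A ω i m B false).card < (tally x A ω i m B true).card) = x i := by
  have h1 : rho n k β ≤ (tally x A ω i m B (x i)).card := hc.trans <| by
    exact_mod_cast Finset.card_le_card (loyalCommittee_subset_tally x A ω i m hB)
  have h2 : (tally x A ω i m B (!x i)).card < (tally x A ω i m B (x i)).card := by
    by_contra! hle
    refine hd ?_
    have h3 : rho n k β ≤ (tally x A ω i m B (!x i)).card := h1.trans (by exact_mod_cast hle)
    cases hx : x i <;> simp [hx] at h1 h3 <;> simp [Disputed, h1, h3]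
  cases hx : x i <;> simp [hx] at h2 ⊢ <;> lia

/-- The induction covers all machines, corrupted ones too: their recorded states keep following the
algorithm, so all machines treat the same bit in the same round, as the one-iteration lemmas
require. -/
lemma invariant (i : ℕ) (hi : i ≤ n) (m : Fin k) : Invariant β x A ω i m := by
  classical
  induction i generalizing m with
  | zero =>
    refine ⟨rfl, rfl, Finset.empty_subset _, ⟨0, ?_, ?_⟩, ?_, ?_⟩ <;>
      simp [Protocol.queryCount, Protocol.messageCount, joinCount]
  | succ i ih =>
    have ih := fun m => ih (by lia) m
    obtain ⟨j, rfl⟩ : ∃ j : Fin n, (j : ℕ) = i := ⟨⟨i, hi⟩, rfl⟩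
    have h := fun m => And.intro (ih m).iter_eq (ih m).votes_eq
    have hstate := state_resolution x A ω h m
    have hq := queryCount_succ x A ω h m
    have hm := messageCount_succ x A ω h m
    have hmono := corrupted_mono A ω (show 2 * (j : ℕ) ≤ 2 * j + 2 by lia)
    obtain ⟨r, hr, hrB⟩ := (ih m).queryCount_eq
    have hsub := (ih m).blacklist_subset
    have hmsg : (blacklistDownload n k β).messageCount x A ω (2 * (j + 1)) m =
        k * joinCount ω (j + 1) m := by
      rw [mul_add, hm, (ih m).messageCount_eq, joinCount_succ]
      split_ifs <;> ring
    -- Serves both branches: `v` is the queried bit or the majority value.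
    have hassign : ∀ v : Bool, ((∀ l < (j : ℕ) + 1, rho n k β ≤ (loyalCommittee A ω l).card) →
        v = x j) → (∀ l < (j : ℕ) + 1, rho n k β ≤ (loyalCommittee A ω l).card) →
        ∀ l : Fin n, (l : ℕ) < j + 1 → assign (st (2 * j) m).res j v l = x l := by
      intro v hv hc l hl
      by_cases hlj : l = j
      · simp [assign, hlj, hv hc]
      · have : (l : ℕ) ≠ j := fun h => hlj (Fin.ext h)
        simp only [assign, this, if_false]
        exact (ih m).res_eq (fun l' hl' => hc l' (by lia)) l (by lia)
    by_cases hd : Disputed x A ω β j m (st (2 * j) m).blacklist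
    · rw [if_pos hd] at hstate hq
      refine ⟨by rw [mul_add, hstate], by rw [mul_add, hstate], ?_, ⟨r + 1, ?_, ?_⟩, hmsg, ?_⟩
      · rw [mul_add, hstate]
        exact (Finset.union_subset hsub (tally_not_subset_corrupted x A ω j m _)).trans hmono
      · rw [mul_add, hq, hr, joinCount_succ]
        ring
      · rw [mul_add, hstate]
        -- Votes of blacklisted machines are ignored, so each dispute contributes new machines and
        -- the cardinalities add.
        have hdisj : Disjoint (st (2 * j) m).blacklist
            (tally x A ω j m (st (2 * j) m).blacklist (!x j)) :=
          Finset.disjoint_right.2 fun a ha => (mem_tally.1 ha).1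
        have hle : rho n k β ≤ (tally x A ω j m (st (2 * j) m).blacklist (!x j)).card := by
          cases x j
          · exact hd.trans (min_le_right _ _)
          · exact hd.trans (min_le_left _ _)
        rw [Finset.card_union_of_disjoint hdisj]
        push_cast
        linarith
      · rw [mul_add, hstate]
        exact hassign _ fun _ => rfl
    · rw [if_neg hd] at hstate hq
      refine ⟨by rw [mul_add, hstate], by rw [mul_add, hstate], ?_, ⟨r, ?_, ?_⟩, hmsg, ?_⟩
      · rw [mul_add, hstate]
        exact hsub.trans hmono
      · rw [mul_add, hq, hr, joinCount_succ]
        ring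
      · rw [mul_add, hstate]
        exact hrB
      · rw [mul_add, hstate]
        exact hassign _ fun hc => res_step x A ω hsub (hc j (by lia)) hd

end Execution

/-! ### The parameters ρ and p -/

section Parameters

variable {n k b : ℕ} {β : ℝ}

lemma half_le_log (hn : 2 ≤ n) : (1 / 2 : ℝ) ≤ Real.log n := by
  have h : Real.log 2 ≤ Real.log n :=
    Real.log_le_log (by norm_num) (by exact_mod_cast hn)
  linarith [Real.log_two_gt_d9]

/-- γk = k - b is a positive integer. -/
lemma one_le_loyal (hβ : β < 1) (hk : 0 < k) (hb : (b : ℝ) = β * k) :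
    1 ≤ (1 - β) * k := by
  have hk' : (0 : ℝ) < k := by exact_mod_cast hk
  have h : (b : ℝ) < k := by rw [hb]; nlinarith
  have h' : (b : ℝ) + 1 ≤ k := by exact_mod_cast h
  rw [hb] at h'
  linarith

lemma one_le_rho : 1 ≤ rho n k β := le_max_left _ _

/-- The square root is at most γ because β ≤ 1 ≤ γk ≤ γn. Needed when p is truncated to 1. -/
lemma rho_le_loyal (hβ1 : β < 1) (hkn : k < n) (h1 : 1 ≤ (1 - β) * k) :
    rho n k β ≤ (1 - β) * k := by
  have hkn' : (k : ℝ) ≤ n := by exact_mod_cast hkn.le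
  have hn : (0 : ℝ) < n := by exact_mod_cast (Nat.zero_le k).trans_lt hkn
  refine max_le h1 ?_
  rw [mul_comm]
  refine mul_le_mul_of_nonneg_right (Real.sqrt_le_iff.2 ⟨by linarith, ?_⟩) (by positivity)
  rw [div_le_iff₀ (by positivity)]
  have h2 : 1 ≤ (1 - β) * n := h1.trans (by gcongr)
  nlinarith

lemma electProb_le (hβ1 : β < 1) :
    (electProb n k β : ℝ) ≤ (9 * Real.log n + 4 * rho n k β) / ((1 - β) * k) := by
  have h0 : 0 ≤ (9 * Real.log n + 4 * rho n k β) / ((1 - β) * k) := by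
    have := Real.log_natCast_nonneg n
    have := one_le_rho (n := n) (k := k) (β := β)
    have : 0 ≤ 1 - β := by linarith
    positivity
  rw [electProb, Set.coe_projIcc]
  exact max_le h0 (min_le_right _ _)

lemma electProb_eq_one_or :
    electProb n k β = 1 ∨
      (9 * Real.log n + 4 * rho n k β) / ((1 - β) * k) ≤ electProb n k β := by
  rcases le_total 1 ((9 * Real.log n + 4 * rho n k β) / ((1 - β) * k)) with h | h
  · left
    rw [electProb, Set.projIcc_of_right_le _ h]
    rfl
  · right
    rw [electProb, Set.coe_projIcc, min_eq_right h]
    exact le_max_right _ _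

end Parameters

/-! ### Committees have enough uncorrupted members -/

section Committee

variable {n k b : ℕ} {β : ℝ}

lemma pi_bernoulli_one_real_exists_false :
    (Measure.pi fun _ : Fin k => bernoulliMeasure true false 1).real {c | ∃ m, c m = false} =
      0 := by
  rw [measureReal_eq_zero_iff, Set.ofPred_exists, measure_iUnion_null_iff]
  intro m
  have h := (measurePreserving_eval (fun _ : Fin k => bernoulliMeasure true false 1)
    m).measure_preimage (s := {false}) (MeasurableSet.of_discrete).nullMeasurableSet
  rw [bernoulliMeasure_one, Measure.dirac_apply] at h
  have h' : (Set.indicator {false} 1 true : ENNReal) = 0 := by simp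
  rw [bernoulliMeasure_one]
  exact h.trans h'

/-- A committee elected from at least `γk` machines has at least `ρ` members, with high
probability. -/
lemma pi_bernoulli_real_committee_lt (hβ1 : β < 1) (hkn : k < n)
    (h1 : 1 ≤ (1 - β) * k) {G : Finset (Fin k)} (hG : (1 - β) * k ≤ G.card) :
    (Measure.pi fun _ : Fin k => bernoulliMeasure true false (electProb n k β)).real
      {c | ((G.filter fun m => c m = true).card : ℝ) < rho n k β} ≤
        Real.exp (-(2 * Real.log n)) := by
  rcases electProb_eq_one_or (n := n) (k := k) (β := β) with hp | hp
  · rw [hp]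
    refine (measureReal_mono (fun c hc => ?_) (by finiteness)).trans
      (pi_bernoulli_one_real_exists_false.trans_le (Real.exp_pos _).le)
    by_contra hall
    simp only [Set.mem_ofPred_eq, not_exists, Bool.not_eq_false] at hall hc
    rw [Finset.filter_true_of_mem fun m _ => hall m] at hc
    linarith [rho_le_loyal hβ1 hkn h1]
  · have hsub : {c : Fin k → Bool | ((G.filter fun m => c m = true).card : ℝ) < rho n k β} ⊆
        {c | ((G.filter fun m => c m = true).card : ℝ) ≤ rho n k β} := 
      Set.ofPred_subset_ofPred_of_imp fun c hc => hc.le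
    refine (measureReal_mono hsub (by finiteness)).trans
      ((measureReal_card_filter_le (iIndepFun_coins_round _) (fun m => by fun_prop)
        (fun m => (measurePreserving_eval _ m).map_eq) G (rho n k β)).trans ?_)
    rw [Real.exp_le_exp]
    rw [div_le_iff₀ (by linarith)] at hp
    have h2 : (1 - β) * k * (electProb n k β : ℝ) ≤ G.card * (electProb n k β : ℝ) :=
      mul_le_mul_of_nonneg_right hG (electProb n k β).2.1
    -- The mean is at least 9 ln n + 4ρ, so the exponent is at most ρ - (9 ln n + 4ρ)/2 ≤ -2 ln n.
    linarith [Real.log_natCast_nonneg n, one_le_rho (n := n) (k := k) (β := β)]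

/-- Corruption precedes the coin tosses of its round; this keeps a committee unpredictable. -/
lemma corrupted_congr (A : Adversary k Bool Bool) {ω ω' : ℕ → Fin k → Bool} {t : ℕ}
    (h : ∀ s < t, ω s = ω' s) : A.corrupted ω t = A.corrupted ω' t := by
  refine Finset.biUnion_congr rfl fun s hs => congrArg _ (funext fun i => h i ?_)
  have := i.2
  have := Finset.mem_range.1 hs
  lia

lemma coins_real_loyalCommittee_lt (hβ1 : β < 1) (hk : 0 < k) (hkn : k < n)
    (hb : (b : ℝ) = β * k) (A : Adversary k Bool Bool) (hA : A.HasBudget b) (i : ℕ) :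
    (coins k (electProb n k β)).real {ω | ((loyalCommittee A ω i).card : ℝ) < rho n k β} ≤
      Real.exp (-(2 * Real.log n)) := by
  -- A finite history padded with arbitrary coins, which `corrupted_congr` shows to be immaterial.
  let past (g : Fin (2 * i) → Fin k → Bool) : ℕ → Fin k → Bool :=
    fun t => if h : t < 2 * i then g ⟨t, h⟩ else fun _ => false
  have key := coins_real_adaptive_le (electProb n k β) (2 * i)
    (fun g => (A.corrupted (past g) (2 * i))ᶜ)
    (fun G => {c | ((G.filter fun m => c m = true).card : ℝ) < rho n k β})
    (fun g => pi_bernoulli_real_committee_lt hβ1 hkn (one_le_loyal hβ1 hk hb) (by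
      have h : ((A.corrupted (past g) (2 * i)).card : ℝ) ≤ b := by exact_mod_cast hA _ _
      rw [Finset.card_compl, Fintype.card_fin, Nat.cast_sub (card_finset_fin_le _)]
      linarith))
  have hpast (ω : ℕ → Fin k → Bool) :
      A.corrupted (past fun j => ω j) (2 * i) = A.corrupted ω (2 * i) :=
    corrupted_congr A fun s hs => by simp [past, hs]
  simp only [hpast] at key
  exact key

end Committee

/-! ### Arithmetic of the complexity bounds -/

section Bounds

variable {n k b : ℕ} {β : ℝ}

/-- Bound the maximum in ρ by the sum of its terms. The term 1 is absorbed using 1 ≤ 2 ln n; the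
other gives exactly √(βn/(8γ)). -/
lemma mul_rho_div_le (hβ0 : 0 ≤ β) (hβ1 : β < 1) (hk : 0 < k) (hkn : k < n) :
    n * rho n k β / ((1 - β) * k) ≤
      2 * (n * Real.log n / ((1 - β) * k)) + √(β / (1 - β) * n) := by
  have hk' : (0 : ℝ) < k := by exact_mod_cast hk
  have hn : (0 : ℝ) < n := by exact_mod_cast hk.trans hkn
  have hγ : 0 < 1 - β := by linarith
  have hL := half_le_log (n := n) (by lia)
  have hrho : rho n k β ≤ 1 + k * √((1 - β) * β / (8 * n)) :=
    max_le (by linarith [show 0 ≤ k * √((1 - β) * β / (8 * n)) by positivity]) (by linarith)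
  have h1 : n * (1 : ℝ) / ((1 - β) * k) ≤ 2 * (n * Real.log n / ((1 - β) * k)) := by
    rw [← mul_div_assoc]
    refine div_le_div_of_nonneg_right ?_ (by positivity)
    nlinarith
  have h2 : n * (k * √((1 - β) * β / (8 * n))) / ((1 - β) * k) ≤ √(β / (1 - β) * n) := by
    refine Real.le_sqrt_of_sq_le ?_
    rw [div_pow, mul_pow, mul_pow, Real.sq_sqrt (by positivity)]
    have : (n : ℝ) ^ 2 * (k ^ 2 * ((1 - β) * β / (8 * n))) / ((1 - β) * k) ^ 2 =
        β / (1 - β) * n / 8 := by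
      field_simp
    rw [this]
    have : 0 ≤ β / (1 - β) * n := by positivity
    linarith
  calc n * rho n k β / ((1 - β) * k)
      ≤ n * (1 + k * √((1 - β) * β / (8 * n))) / ((1 - β) * k) := by gcongr
    _ = n * (1 : ℝ) / ((1 - β) * k) + n * (k * √((1 - β) * β / (8 * n))) / ((1 - β) * k) := by
      ring
    _ ≤ _ := add_le_add h1 h2

/-- The mean number of committees that a machine joins, and the deviation allowed from it. -/
lemma two_mul_electProb_add_le (hβ0 : 0 ≤ β) (hβ1 : β < 1) (hk : 0 < k) (hkn : k < n) :
    2 * (n * (electProb n k β : ℝ)) + 2 * Real.log n ≤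
      36 * (n * Real.log n / ((1 - β) * k)) + 8 * √(β / (1 - β) * n) := by
  have hk' : (0 : ℝ) < k := by exact_mod_cast hk
  have hkn' : (k : ℝ) ≤ n := by exact_mod_cast hkn.le
  have hγ : 0 < 1 - β := by linarith
  have hL : 0 ≤ Real.log n := Real.log_natCast_nonneg n
  have h1 : Real.log n ≤ n * Real.log n / ((1 - β) * k) := by
    rw [le_div_iff₀ (by positivity), mul_comm]
    gcongr
    nlinarith
  have h2 : n * (electProb n k β : ℝ) ≤ 9 * (n * Real.log n / ((1 - β) * k)) +
      4 * (n * rho n k β / ((1 - β) * k)) :=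
    (mul_le_mul_of_nonneg_left (electProb_le hβ1) (by positivity)).trans_eq (by ring)
  -- The constants are 36 = 2(9 + 4 · 2) + 2 and 8 = 2 · 4.
  linarith [mul_rho_div_le hβ0 hβ1 hk hkn]

/-- Bounds the number βk/ρ of disputes. The product of the two roots is β/√8, and √8 < 3. -/
lemma mul_le_sqrt_mul_rho (hβ0 : 0 ≤ β) (hβ1 : β < 1) (hn : 0 < n) :
    β * k ≤ 3 * √(β / (1 - β) * n) * rho n k β := by
  have hn' : (0 : ℝ) < n := by exact_mod_cast hn
  have hγ : 0 < 1 - β := by linarith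
  have h1 : β / 3 ≤ √(β / (1 - β) * n) * √((1 - β) * β / (8 * n)) := by
    rw [← Real.sqrt_mul (by positivity)]
    refine Real.le_sqrt_of_sq_le ?_
    have : β / (1 - β) * n * ((1 - β) * β / (8 * n)) = β ^ 2 / 8 := by field_simp
    rw [this]
    nlinarith [sq_nonneg β]
  calc β * k = 3 * (β / 3) * k := by ring
    _ ≤ 3 * (√(β / (1 - β) * n) * √((1 - β) * β / (8 * n))) * k := by gcongr
    _ = 3 * √(β / (1 - β) * n) * (k * √((1 - β) * β / (8 * n))) := by ring
    _ ≤ _ := by gcongr; exact le_max_right _ _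

/-- Drop β ≤ 1 and use √(n/γ) = √(γn)/γ, the form occurring in the message bound. -/
lemma sqrt_ratio_le (hβ1 : β < 1) : √(β / (1 - β) * n) ≤ √((1 - β) * n) / (1 - β) := by
  have hγ : 0 < 1 - β := by linarith
  refine Real.sqrt_le_iff.2 ⟨by positivity, ?_⟩
  rw [div_pow, Real.sq_sqrt (by positivity)]
  have : (1 - β) * n / (1 - β) ^ 2 = 1 / (1 - β) * n := by field_simp
  rw [this]
  gcongr

end Bounds

/-! ### Union bound and conclusion -/

section Main

variable {n k b : ℕ} {β : ℝ}

/-- The execution succeeds within the bounds if all committees have enough uncorrupted members and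
no machine joins too many of them. -/
lemma downloadsWithin (hβ0 : 0 ≤ β) (hβ1 : β < 1) (hk : 0 < k) (hkn : k < n)
    (hb : (b : ℝ) = β * k) (x : Fin n → Bool) (A : Adversary k Bool Bool) (hA : A.HasBudget b)
    (ω : ℕ → Fin k → Bool) (hc : ∀ i < n, rho n k β ≤ (loyalCommittee A ω i).card)
    (hj : ∀ m, (joinCount ω n m : ℝ) ≤ 2 * (n * (electProb n k β : ℝ)) + 2 * Real.log n) :
    (blacklistDownload n k β).DownloadsWithin x A ω
      (100 * (n * Real.log n / ((1 - β) * k) + √(β / (1 - β) * n))) (100 * n)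
      (fun h => 100 * (h / ((1 - β) * k)) * (k * n * Real.log n + k ^ 2 * √((1 - β) * n))) := by
  have hk' : (0 : ℝ) < k := by exact_mod_cast hk
  have hγ : 0 < 1 - β := by linarith
  have hL : 0 ≤ Real.log n := Real.log_natCast_nonneg n
  have hD : 0 ≤ n * Real.log n / ((1 - β) * k) := by positivity
  have hR : 0 ≤ √(β / (1 - β) * n) := Real.sqrt_nonneg _
  have hj' := fun m => (hj m).trans (two_mul_electProb_add_le hβ0 hβ1 hk hkn)
  have inv := fun m => invariant (β := β) x A ω n le_rfl m
  -- Two rounds for each bit.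
  refine ⟨2 * n, ?_, fun m _ => ?_, fun m _ => ?_, ?_⟩
  · push_cast
    linarith [(Nat.cast_nonneg n : (0 : ℝ) ≤ n)]
  · simp only [(inv m).iter_eq, if_true]
    exact congrArg some (funext fun j => (inv m).res_eq hc j j.2)
  · obtain ⟨r, hr, hrB⟩ := (inv m).queryCount_eq
    have hB : (((blacklistDownload n k β).state x A ω (2 * n) m).blacklist.card : ℝ) ≤ β * k := by
      rw [← hb]
      exact_mod_cast (Finset.card_le_card (inv m).blacklist_subset).trans (hA ω _)
    -- Cancel ρ in rρ ≤ |B| ≤ βk ≤ 3√(βn/γ) ρ.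
    have hr3 : (r : ℝ) ≤ 3 * √(β / (1 - β) * n) :=
      le_of_mul_le_mul_right ((hrB.trans hB).trans (mul_le_sqrt_mul_rho hβ0 hβ1 (by lia)))
        (zero_lt_one.trans_le one_le_rho)
    rw [hr]
    push_cast
    linarith [hj' m]
  · simp only [(inv _).messageCount_eq]
    push_cast
    -- Only committee members send, k messages per committee joined.
    calc ∑ m ∈ A.honest ω, (k : ℝ) * joinCount ω n m
        ≤ ∑ m ∈ A.honest ω, (k : ℝ) * (100 * (n * Real.log n / ((1 - β) * k) +
            √((1 - β) * n) / (1 - β))) := by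
          gcongr with m
          linarith [hj' m, sqrt_ratio_le (n := n) hβ1]
      _ = _ := by
          rw [Finset.sum_const, nsmul_eq_mul]
          field_simp

/-- The bounds with an absolute constant. -/
theorem solvesDownload_blacklistDownload (hβ0 : 0 ≤ β) (hβ1 : β < 1) (hk : 0 < k) (hkn : k < n)
    (hb : (b : ℝ) = β * k) :
    (blacklistDownload n k β).SolvesDownload b (100 / n) (100 * Real.log n)
      (100 * (n * Real.log n / ((1 - β) * k) + √(β / (1 - β) * n))) (100 * n)
      (fun h => 100 * (h / ((1 - β) * k)) * (k * n * Real.log n + k ^ 2 * √((1 - β) * n))) := by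
  have hn : (0 : ℝ) < n := by exact_mod_cast hk.trans hkn
  refine ⟨?_, fun x A hA => ?_⟩
  · have h : (blacklistDownload n k β).messageBits = 1 := by
      rw [Protocol.messageBits, Nat.card_eq_fintype_card, Fintype.card_bool]
      decide
    rw [h]
    push_cast
    linarith [half_le_log (n := n) (by lia)]
  · set a := Real.exp (-(2 * Real.log n)) with ha
    have ha' : a = 1 / (n : ℝ) ^ 2 := by
      rw [ha, Real.exp_neg, mul_comm, Real.exp_mul, Real.exp_log hn]
      norm_num
    let small (i : ℕ) : Set (ℕ → Fin k → Bool) :=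
      {ω | ((loyalCommittee A ω i).card : ℝ) < rho n k β}
    let busy (m : Fin k) : Set (ℕ → Fin k → Bool) :=
      {ω | 2 * (n * (electProb n k β : ℝ)) + 2 * Real.log n ≤ (joinCount ω n m : ℝ)}
    have hsub : {ω | ¬ (blacklistDownload n k β).DownloadsWithin x A ω
        (100 * (n * Real.log n / ((1 - β) * k) + √(β / (1 - β) * n))) (100 * n)
        (fun h => 100 * (h / ((1 - β) * k)) *
          (k * n * Real.log n + k ^ 2 * √((1 - β) * n)))} ⊆
        (⋃ i ∈ Finset.range n, small i) ∪ ⋃ m ∈ (Finset.univ : Finset (Fin k)), busy m := by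
      intro ω hω
      by_contra h
      simp only [small, busy, Set.mem_union, Set.mem_iUnion, Set.mem_ofPred_eq, Finset.mem_range,
        Finset.mem_univ, not_or, not_exists, not_lt, not_le] at h
      exact hω (downloadsWithin hβ0 hβ1 hk hkn hb x A hA ω h.1 fun m => (h.2 m trivial).le)
    have hle : (coins k (electProb n k β)).real
        ((⋃ i ∈ Finset.range n, small i) ∪ ⋃ m ∈ (Finset.univ : Finset (Fin k)), busy m) ≤
        100 / n := by
      -- The n committee events and k machine events have probability at most `a` = 1/n² each.
      refine (measureReal_union_le _ _).trans ((add_le_add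
        ((measureReal_biUnion_finset_le _ _).trans (Finset.sum_le_card_nsmul _ _ a fun i _ =>
          coins_real_loyalCommittee_lt hβ1 hk hkn hb A hA i))
        ((measureReal_biUnion_finset_le _ _).trans (Finset.sum_le_card_nsmul _ _ a fun m _ =>
          coins_le_card_filter _ m (mul_right_injective₀ two_ne_zero) n _))).trans ?_)
      have hkn' : (k : ℝ) ≤ n := by exact_mod_cast hkn.le
      rw [Finset.card_range, Finset.card_univ, Fintype.card_fin, nsmul_eq_mul, nsmul_eq_mul, ha',
        ← add_mul, mul_one_div, div_le_div_iff₀ (by positivity) hn]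
      nlinarith
    refine (measure_mono hsub).trans ?_
    have hfin := measure_ne_top (coins k (electProb n k β))
    refine (ENNReal.ofReal_toReal (hfin _)).ge.trans ?_
    exact ENNReal.ofReal_le_ofReal hle

/-- Message bounds need comparing only up to `k`, the largest possible number of honest machines. -/
lemma Protocol.SolvesDownload.mono {P : Protocol n k} {fail fail' bits bits' Q Q' T T' : ℝ}
    {M M' : ℕ → ℝ} (h : P.SolvesDownload b fail bits Q T M) (hfail : fail ≤ fail')
    (hbits : bits ≤ bits') (hQ : Q ≤ Q') (hT : T ≤ T') (hM : ∀ l ≤ k, M l ≤ M' l) :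
    P.SolvesDownload b fail' bits' Q' T' M' := by
  refine ⟨h.1.trans hbits, fun x A hA => le_trans (measure_mono ?_)
    ((h.2 x A hA).trans (ENNReal.ofReal_le_ofReal hfail))⟩
  rw [Set.ofPred_subset_ofPred]
  refine fun ω hω hd => hω ?_
  obtain ⟨t, ht, hout, hq, hm⟩ := hd
  exact ⟨t, ht.trans hT, hout, fun m hm => (hq m hm).trans hQ,
    hm.trans (hM _ (card_finset_fin_le _))⟩

end Main

end CCA

/-- With `γ = 1 - β`. First part: for every fixed `β < 1`, the stated bounds with constants that
may depend on `β`. Second part: the bounds with absolute constants, uniformly in `β`. -/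
theorem mainTheorem2 :
    (∀ β : ℝ, 0 ≤ β → β < 1 → ∃ C : ℝ, 0 < C ∧
      ∀ n k b : ℕ, 0 < k → k < n → (b : ℝ) = β * k →
        (CCA.blacklistDownload n k β).SolvesDownload b
          (C / n)
          (C * Real.log n)
          (C * (n * Real.log n / ((1 - β) * k) + √n))
          (C * n)
          (fun _ => C * (k * n * Real.log n + k ^ 2 * √((1 - β) * n)))) ∧
    (∃ C : ℝ, 0 < C ∧
      ∀ (β : ℝ) (n k b : ℕ), 0 ≤ β → β < 1 → 0 < k → k < n → (b : ℝ) = β * k →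
        (CCA.blacklistDownload n k β).SolvesDownload b
          (C / n)
          (C * Real.log n)
          (C * (n * Real.log n / ((1 - β) * k) + √(β / (1 - β) * n)))
          (C * n)
          (fun h => C * (h / ((1 - β) * k)) *
            (k * n * Real.log n + k ^ 2 * √((1 - β) * n)))) := by
  refine ⟨fun β hβ0 hβ1 => ?_, 100, by norm_num, fun β n k b hβ0 hβ1 hk hkn hb =>
    CCA.solvesDownload_blacklistDownload hβ0 hβ1 hk hkn hb⟩
  have hγ : 0 < 1 - β := by linarith
  have hC : 100 ≤ 100 / (1 - β) := by
    rw [le_div_iff₀ hγ]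
    linarith
  -- One factor 1/γ suffices: it pays for √(β/γ) ≤ 1/γ in the queries and for h/(γk) ≤ 1/γ in the
  -- messages.
  refine ⟨100 / (1 - β), by positivity, fun n k b hk hkn hb =>
    (CCA.solvesDownload_blacklistDownload hβ0 hβ1 hk hkn hb).mono (by gcongr) ?_ ?_ (by gcongr)
      fun l hl => ?_⟩
  · have := Real.log_natCast_nonneg n
    gcongr
  · have := Real.log_natCast_nonneg n
    have hR : √(β / (1 - β) * n) ≤ √n / (1 - β) :=
      (CCA.sqrt_ratio_le hβ1).trans (by gcongr; nlinarith [(Nat.cast_nonneg n : (0 : ℝ) ≤ n)])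
    have hD : 0 ≤ n * Real.log n / ((1 - β) * k) := by positivity
    calc 100 * (n * Real.log n / ((1 - β) * k) + √(β / (1 - β) * n))
        ≤ 100 * (n * Real.log n / ((1 - β) * k)) + 100 * (√n / (1 - β)) := by linarith
      _ ≤ 100 / (1 - β) * (n * Real.log n / ((1 - β) * k)) + 100 * (√n / (1 - β)) := by gcongr
      _ = _ := by ring
  · have := Real.log_natCast_nonneg n
    have hk' : (0 : ℝ) < k := by exact_mod_cast hk
    have hl' : (l : ℝ) ≤ k := by exact_mod_cast hl
    have h : 100 * (l / ((1 - β) * k)) ≤ 100 / (1 - β) := by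
      rw [← mul_div_assoc, div_le_div_iff₀ (by positivity) hγ]
      nlinarith
    gcongr
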